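/- Let $T$ be any index set and let $E$ be a standard Borel space (for instance $\mathbb R^d$). To every finite list of indices $t=(t_1,\dots,t_n)$ let there be assigned a probability measure $P_{t_1,\dots,t_n}$ on $E^n$, the proposed joint law of $(x_{t_1},\dots,x_{t_n})$. Either only lists of pairwise distinct indices are admitted, or all finite lists, with repeated indices allowed (several observations at the same index); the result holds in both settings. Suppose that the hypotheses of the Kolmogorov extension theorem hold: - (Exchangeability) for every $n$, every admissible $(t_1,\dots,t_n)$ and every permutation $\pi$ of $\{1,\dots,n\}$, if $(x_1,\dots,x_n)\sim P_{t_1,\dots,t_n}$ then $(x_{\pi(1)},\dots,x_{\pi(n)})\sim P_{t_{\pi(1)},\dots,t_{\pi(n)}}$; - (Consistency) for $1\le m\le n$ and every admissible $(t_1,\dots,t_n)$, the marginal of $P_{t_1,\dots,t_n}$ on the first $m$ coordinates is $P_{t_1,\dots,t_m}$. Then the process is represented by a latent-variable model: there are an index set $S$ (finite or infinite), a probability measure $p(d\theta)$ on $\mathbb R^S$ with its product $\sigma$-algebra, and for each $t\in T$ a Markov kernel $p(dx\mid\theta,t)$ from $\mathbb R^S$ to $E$, such that for every $n$ and every admissible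 $(t_1,\dots,t_n)$ $$P_{t_1,\dots,t_n}(dx_1\cdots dx_n)=\int \prod_{i=1}^n p(dx_i\mid\theta,t_i)\;p(d\theta).$$ That is, one draws $\theta\sim p(\theta)$ and then, independently given $\theta$, $x_{t_i}\sim p(x\mid\theta,t_i)$ for $i=1,\dots,n$. The same prior and kernels serve all $n$ and all index lists. Conversely, for every latent-variable model, with values of $\theta$ in an arbitrary measurable space, the measures given by this formula are probability measures that satisfy exchangeability and consistency. -/

import Mathlib

open MeasureTheory ProbabilityTheory

universe u v w

/-- A system of candidate finite-dimensional marginals: to every finite list of indices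
`t = (t₁, …, tₙ)` it assigns a measure `P n t` on `Eⁿ`, the candidate joint law
`p(x_{t₁}, …, x_{tₙ} | t₁, …, tₙ)`. -/
abbrev MarginalSystem (T E : Type*) [MeasurableSpace E] : Type _ :=
  ∀ n : ℕ, (Fin n → T) → Measure (Fin n → E)

/-- The lists of pairwise distinct indices. -/
def distinctIndices (T : Type*) (n : ℕ) : Set (Fin n → T) :=
  {t | Function.Injective t}

/-- All lists of indices, repetitions allowed. -/
def allIndices (T : Type*) (n : ℕ) : Set (Fin n → T) :=
  Set.univ

namespace MarginalSystem

variable {T E : Type*} [MeasurableSpace E]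

/-- The marginals at the index lists in `D` are probability measures. -/
def IsProbabilityOn (D : ∀ n : ℕ, Set (Fin n → T)) (P : MarginalSystem T E) : Prop :=
  ∀ (n : ℕ) (t : Fin n → T), t ∈ D n → IsProbabilityMeasure (P n t)

/-- Exchangeability: permuting the indices permutes the variables. If `(x₁, …, xₙ)` has law
`P n (t₁, …, tₙ)`, then `(x_{π 1}, …, x_{π n})` has law `P n (t_{π 1}, …, t_{π n})`. -/
def IsExchangeableOn (D : ∀ n : ℕ, Set (Fin n → T)) (P : MarginalSystem T E) : Prop :=
  ∀ (n : ℕ) (t : Fin n → T), t ∈ D n → ∀ π : Equiv.Perm (Fin n),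
    P n (t ∘ π) = (P n t).map (fun x => x ∘ π)

/-- Consistency: for `1 ≤ m ≤ n`, integrating the last `n - m` variables out of the marginal at
`(t₁, …, tₙ)` gives the marginal at `(t₁, …, tₘ)`. -/
def IsConsistentOn (D : ∀ n : ℕ, Set (Fin n → T)) (P : MarginalSystem T E) : Prop :=
  ∀ (m n : ℕ) (_ : 1 ≤ m) (h : m ≤ n) (t : Fin n → T), t ∈ D n →
    P m (t ∘ Fin.castLE h) = (P n t).map (fun x => x ∘ Fin.castLE h)

end MarginalSystem

/-- A latent-variable model with latent space `Θ`, index set `T` and observation space `E`: a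
prior probability `p(θ)` and, for each index `t`, a Markov kernel `p(x | θ, t)`. -/
structure LatentVariableModel (Θ T E : Type*) [MeasurableSpace Θ] [MeasurableSpace E] where
  /-- The distribution `p(θ)` of the latent variable. -/
  prior : Measure Θ
  /-- The conditional distribution `p(x | θ, t)` of a single observation at index `t`. -/
  likelihood : T → Kernel Θ E
  isProbabilityMeasure_prior : IsProbabilityMeasure prior
  isMarkovKernel_likelihood : ∀ t, IsMarkovKernel (likelihood t)

namespace LatentVariableModel

variable {Θ T E : Type*} [MeasurableSpace Θ] [MeasurableSpace E]

theorem measurable_pi_likelihood (M : LatentVariableModel Θ T E) {n : ℕ} (t : Fin n → T) :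
    Measurable fun θ => Measure.pi fun i => M.likelihood (t i) θ := by
  have := M.isMarkovKernel_likelihood
  refine Measurable.measure_of_isPiSystem_of_isProbabilityMeasure
    generateFrom_pi.symm isPiSystem_pi ?_
  rintro _ ⟨s, hs, rfl⟩
  simp only [Measure.pi_pi]
  exact Finset.measurable_prod _ fun i _ =>
    Kernel.measurable_coe _ (hs i (Set.mem_univ i))

/-- Given `θ`, the observations at `t₁, …, tₙ` are independent, the `i`-th with law
`p(x | θ, tᵢ)`. -/
noncomputable def observations (M : LatentVariableModel Θ T E) {n : ℕ} (t : Fin n → T) :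
    Kernel Θ (Fin n → E) where
  toFun θ := Measure.pi fun i => M.likelihood (t i) θ
  measurable' := M.measurable_pi_likelihood t

/-- The law of the observations at `t₁, …, tₙ` once `θ` is drawn from the prior:
`∫ ∏ᵢ p(xᵢ | θ, tᵢ) p(dθ)`. -/
noncomputable def marginals (M : LatentVariableModel Θ T E) : MarginalSystem T E :=
  fun _ t => M.prior.bind (M.observations t)

/-- The model `M` represents the system `P` at the index lists in `D`. -/
def Represents (M : LatentVariableModel Θ T E) (D : ∀ n : ℕ, Set (Fin n → T))
    (P : MarginalSystem T E) : Prop :=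
  ∀ (n : ℕ) (t : Fin n → T), t ∈ D n → P n t = M.marginals n t

end LatentVariableModel

/-! Exchangeability and consistency together say that marginals restrict along every injection of
positions (`eq_map_comp_of_injective`), which is what Kolmogorov extension needs. For distinct
indices the extension is a law on paths `T → E`; the path itself is the latent variable and the
kernels are Dirac masses at its coordinates.

With repetitions, observations at one index may differ, so the extension is made on arrays `T × ℕ →
E`, with infinitely many observations per index. The law of the array is invariant under all
injections that keep every cell in its row. A de Finetti argument follows. Shift all rows by one
column and condition an entry of column 0 on the shifted array. Forgetting one more column does not
change the conditional probability: both versions have the same second moment, equal to their cross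
moment, so they agree almost surely (`condDistrib_comp_ae_eq`). Peeling off one observation at a
time then gives conditional independence (`lintegral_mul_prod_indicator_iterate`), with the array as
latent variable.

A coordinatewise Borel embedding of `E` makes the latent variable a family of reals. The converse
holds because product measures restrict to product measures along injections. -/

namespace MeasureTheory

/-! ### Kolmogorov extension for standard Borel spaces. -/

/-- **Kolmogorov extension along `ℕ`**: a consistent sequence of laws of initial segments is the
sequence of initial marginals of a law on paths. -/
theorem exists_measure_map_frestrictLe {E : Type*} [MeasurableSpace E] [StandardBorelSpace E]
    [Nonempty E] (Q : ∀ n : ℕ, Measure (Finset.Iic n → E)) [∀ n, IsProbabilityMeasure (Q n)]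
    (hQ : ∀ n, (Q (n + 1)).map (Preorder.frestrictLe₂ (π := fun _ => E) n.le_succ) = Q n) :
    ∃ ν : Measure (ℕ → E), IsProbabilityMeasure ν ∧
      ∀ n, ν.map (Preorder.frestrictLe (π := fun _ => E) n) = Q n := by
  let last (n : ℕ) : (Finset.Iic (n + 1) → E) → E := fun x => x ⟨n + 1, by simp⟩
  have hlast n : Measurable (last n) := measurable_pi_apply _
  -- Each law is disintegrated over its initial segment; the Ionescu-Tulcea construction chains
  -- these kernels.
  let κ (n : ℕ) : Kernel (Finset.Iic n → E) E :=
    condDistrib (last n) (Preorder.frestrictLe₂ (π := fun _ => E) n.le_succ) (Q (n + 1))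
  have hκ (n : ℕ) : IsMarkovKernel (κ n) := by unfold κ; infer_instance
  have hfst : Measurable fun x : Finset.Iic 0 → E => x ⟨0, by simp⟩ := measurable_pi_apply _
  let μ₀ : Measure E := (Q 0).map fun x => x ⟨0, by simp⟩
  have hμ₀ : IsProbabilityMeasure μ₀ := Measure.isProbabilityMeasure_map hfst.aemeasurable
  let ν : Measure (ℕ → E) := Kernel.trajMeasure (X := fun _ => E) μ₀ κ
  refine ⟨ν, inferInstanceAs
    (IsProbabilityMeasure (Kernel.trajMeasure (X := fun _ => E) μ₀ κ)), fun n => ?_⟩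
  induction n with
  | zero =>
    have h0 : ν.map (Preorder.frestrictLe (π := fun _ => E) 0) =
        μ₀.map (MeasurableEquiv.piUnique (fun _ : Finset.Iic 0 => E)).symm := by
      unfold ν Kernel.trajMeasure
      rw [Measure.map_comp _ _ (by fun_prop), Kernel.traj_map_frestrictLe,
        Kernel.partialTraj_self, Measure.id_comp]
    rw [h0, Measure.map_map (by fun_prop) hfst]
    convert Measure.map_id
    ext x i
    obtain ⟨i, hi⟩ := i
    obtain rfl : i = 0 := by simpa using hi
    rfl
  | succ n ih =>
    have h1 := Kernel.map_frestrictLe_trajMeasure_compProd_eq_map_trajMeasure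
      (X := fun _ => E) (μ₀ := μ₀) (κ := κ) (a := n)
    change ν.map _ ⊗ₘ κ n = ν.map _ at h1
    have h2 : Q n ⊗ₘ κ n = (Q (n + 1)).map fun x =>
        (Preorder.frestrictLe₂ (π := fun _ => E) n.le_succ x, last n x) := by
      rw [← hQ n]
      exact compProd_map_condDistrib (hlast n).aemeasurable
    rw [ih, h2] at h1
    let glue : (Finset.Iic n → E) × E → (Finset.Iic (n + 1) → E) := fun p i =>
      if h : i.1 ≤ n then p.1 ⟨i.1, by simpa using h⟩ else p.2
    have hglue : Measurable glue := by
      refine measurable_pi_lambda _ fun i => ?_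
      by_cases h : i.1 ≤ n
      · simp only [glue, h, dif_pos]; fun_prop
      · simp only [glue, h]; exact measurable_snd
    have glue_eq (x : Finset.Iic (n + 1) → E) :
        glue (Preorder.frestrictLe₂ (π := fun _ => E) n.le_succ x, last n x) = x := by
      ext i
      by_cases h : i.1 ≤ n
      · simp [glue, h]
      · have hi : i.1 = n + 1 := by have := Finset.mem_Iic.1 i.2; omega
        simp only [glue, h, dif_neg, not_false_eq_true, last]
        congr 1
        exact Subtype.ext hi.symm
    have h3 := congrArg (Measure.map glue) h1
    rw [Measure.map_map hglue
      ((Preorder.measurable_frestrictLe₂ (X := fun _ => E) n.le_succ).prodMk (hlast n)), Measure.map_map hglue (by fun_prop)] at h3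
    have e1 : (glue ∘ fun x => (Preorder.frestrictLe₂ (π := fun _ => E) n.le_succ x, last n x))
        = id := funext glue_eq
    have e2 : (glue ∘ fun x : ℕ → E => (Preorder.frestrictLe (π := fun _ => E) n x, x (n + 1)))
        = Preorder.frestrictLe (π := fun _ => E) (n + 1) :=
      funext fun x => glue_eq (Preorder.frestrictLe (π := fun _ => E) (n + 1) x)
    rw [e1, e2, Measure.map_id] at h3
    exact h3.symm

variable {I E : Type*} [MeasurableSpace E]

/-- A projective family on an arbitrary index set is realised by a measure on the full product, as
far as the coordinates in a countable set are concerned. -/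
theorem IsProjectiveMeasureFamily.exists_measure_of_countable [StandardBorelSpace E]
    {P : ∀ J : Finset I, Measure (J → E)} [∀ J, IsProbabilityMeasure (P J)]
    (hP : IsProjectiveMeasureFamily (α := fun _ => E) P) {C : Set I} (hC : C.Countable) :
    ∃ μ : Measure (I → E), IsProbabilityMeasure μ ∧
      ∀ J : Finset I, (J : Set I) ⊆ C → μ.map (J.restrict (π := fun _ => E)) = P J := by
  classical
  rcases C.eq_empty_or_nonempty with rfl | hne
  · rcases isEmpty_or_nonempty (I → E) with hemp | ⟨⟨x⟩⟩
    · have := hP.eq_zero_of_isEmpty ∅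
      exact absurd this (IsProbabilityMeasure.ne_zero _)
    · refine ⟨Measure.dirac x, inferInstance, fun J hJ => ?_⟩
      obtain rfl : J = ∅ := by simpa using hJ
      have := Measure.isProbabilityMeasure_map (μ := Measure.dirac x)
        (Finset.measurable_restrict (X := fun _ : I => E) ∅).aemeasurable
      ext s hs
      rcases s.eq_empty_or_nonempty with rfl | h
      · simp
      · rw [Subsingleton.eq_univ_of_nonempty h, measure_univ, measure_univ]
  obtain ⟨e, rfl⟩ := hC.exists_eq_range hne
  have hE : Nonempty E := by
    obtain ⟨x⟩ := nonempty_of_isProbabilityMeasure (P {e 0})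
    exact ⟨x ⟨e 0, by simp⟩⟩
  -- The enumeration `e` may repeat, so `J n` can have fewer than `n + 1` elements; `pull` copies
  -- coordinates accordingly.
  let J (n : ℕ) : Finset I := (Finset.Iic n).image e
  have mem_J {n k : ℕ} (h : k ≤ n) : e k ∈ J n :=
    Finset.mem_image_of_mem _ (Finset.mem_Iic.2 h)
  let pull (n : ℕ) : (J n → E) → (Finset.Iic n → E) := fun x i =>
    x ⟨e i, mem_J (Finset.mem_Iic.1 i.2)⟩
  have hpull n : Measurable (pull n) := measurable_pi_lambda _ fun i => measurable_pi_apply _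
  let Q (n : ℕ) : Measure (Finset.Iic n → E) := (P (J n)).map (pull n)
  have hQ n : IsProbabilityMeasure (Q n) := Measure.isProbabilityMeasure_map (hpull n).aemeasurable
  obtain ⟨ν, hν, hνQ⟩ := exists_measure_map_frestrictLe Q fun n => by
    have hsub : J n ⊆ J (n + 1) := Finset.image_subset_image (Finset.Iic_subset_Iic.2 n.le_succ)
    simp only [Q]
    rw [hP _ _ hsub,
      Measure.map_map (Preorder.measurable_frestrictLe₂ (X := fun _ => E) n.le_succ) (hpull _),
      Measure.map_map (hpull _) (Finset.measurable_restrict₂ hsub)]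
    rfl
  -- One position is chosen for each index. Off the range of `e` its value is junk, which no `K ⊆ C`
  -- reads.
  let r : I → ℕ := Function.invFun e
  have hr {i : I} (hi : i ∈ Set.range e) : e (r i) = i := Function.invFun_eq hi
  have hcomp : Measurable fun y : ℕ → E => y ∘ r :=
    measurable_pi_lambda _ fun i => measurable_pi_apply _
  refine ⟨ν.map fun y => y ∘ r, Measure.isProbabilityMeasure_map hcomp.aemeasurable,
    fun K hK => ?_⟩
  let N := K.sup r
  have hN {i : I} (hi : i ∈ K) : r i ≤ N := Finset.le_sup hi
  have hKJ : K ⊆ J N := fun i hi => hr (hK hi) ▸ mem_J (hN hi)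
  let pick : (Finset.Iic N → E) → (K → E) := fun y i => y ⟨r i, Finset.mem_Iic.2 (hN i.2)⟩
  have hpick : Measurable pick := measurable_pi_lambda _ fun i => measurable_pi_apply _
  have h1 : (ν.map fun y => y ∘ r).map (K.restrict (π := fun _ => E)) =
      (ν.map (Preorder.frestrictLe (π := fun _ => E) N)).map pick := by
    rw [Measure.map_map (Finset.measurable_restrict K) hcomp, Measure.map_map hpick (by fun_prop)]
    rfl
  rw [h1, hνQ, hP _ _ hKJ, Measure.map_map hpick (hpull N)]
  congr 1
  ext x i
  simp only [Function.comp_apply, pick, pull, Finset.restrict₂]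
  congr 1
  exact Subtype.ext (hr (hK i.2))

/-- **Kolmogorov extension theorem** for copies of a standard Borel space. -/
theorem IsProjectiveMeasureFamily.exists_isProjectiveLimit [StandardBorelSpace E]
    {P : ∀ J : Finset I, Measure (J → E)} [∀ J, IsProbabilityMeasure (P J)]
    (hP : IsProjectiveMeasureFamily (α := fun _ => E) P) :
    ∃ μ : Measure (I → E), IsProbabilityMeasure μ ∧
      ∀ J : Finset I, μ.map (J.restrict (π := fun _ => E)) = P J := by
  -- Countably many cylinders involve countably many coordinates, and there the content agrees with
  -- a genuine measure, which is continuous from above.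
  have tendsto_zero ⦃A : ℕ → Set (I → E)⦄ (hA : ∀ n, A n ∈ measurableCylinders fun _ : I => E)
      (anti : Antitone A) (inter : ⋂ n, A n = ∅) :
      Filter.Tendsto (fun n => projectiveFamilyContent hP (A n)) Filter.atTop (nhds 0) := by
    have hcyl n := (mem_measurableCylinders _).1 (hA n)
    choose s S hS hAS using hcyl
    obtain ⟨μ, hμ, hμP⟩ := hP.exists_measure_of_countable
      (Set.countable_iUnion fun n => (s n).countable_toSet)
    have hμA n : projectiveFamilyContent hP (A n) = μ (A n) := by
      rw [projectiveFamilyContent_congr hP _ (hAS n) (hS n),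
        ← hμP _ (Set.subset_iUnion (fun n => (s n : Set I)) n),
        Measure.map_apply (Finset.measurable_restrict _) (hS n), hAS n]
      rfl
    simp_rw [hμA]
    have := tendsto_measure_iInter_atTop (μ := μ)
      (fun n => (MeasurableSet.of_mem_measurableCylinders (hA n)).nullMeasurableSet) anti
      ⟨0, measure_ne_top _ _⟩
    rwa [inter, measure_empty] at this
  have hsub : (projectiveFamilyContent hP).IsSigmaSubadditive :=
    isSigmaSubadditive_of_addContent_iUnion_eq_tsum isSetRing_measurableCylinders
      fun f hf hU hd => addContent_iUnion_eq_sum_of_tendsto_zero isSetRing_measurableCylinders _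
        (fun _ _ => projectiveFamilyContent_ne_top hP) tendsto_zero hf hU hd
  let μ : Measure (I → E) := (projectiveFamilyContent hP).measure isSetSemiring_measurableCylinders
    generateFrom_measurableCylinders.ge hsub
  have hμ : IsProjectiveLimit (α := fun _ => E) μ P := by
    intro J
    ext S hS
    rw [Measure.map_apply (Finset.measurable_restrict J) hS]
    exact (AddContent.measure_eq _ _ generateFrom_measurableCylinders.symm _
      (cylinder_mem_measurableCylinders J S hS)).trans (projectiveFamilyContent_cylinder hP hS)
  exact ⟨μ, hμ.isProbabilityMeasure, hμ⟩

/-! ### Projections of product measures, and measures on a point. -/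

/-- Reading off the coordinates along an injection maps a product measure to a product measure. -/
theorem Measure.pi_map_comp_injective {ι κ : Type*} [Fintype ι] [Fintype κ] (ν : κ → Measure E)
    [∀ k, IsProbabilityMeasure (ν k)] {σ : ι → κ} (hσ : Function.Injective σ) :
    (Measure.pi ν).map (fun x => x ∘ σ) = Measure.pi fun i => ν (σ i) := by
  have hmeas : Measurable fun x : κ → E => x ∘ σ :=
    measurable_pi_lambda _ fun i => measurable_pi_apply _
  refine (Measure.pi_eq fun A hA => ?_).symm
  have hpre : (fun x : κ → E => x ∘ σ) ⁻¹' Set.univ.pi A =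
      Set.univ.pi (Function.extend σ A fun _ => Set.univ) := by
    ext x
    simp only [Set.mem_preimage, Set.mem_univ_pi, Function.comp_apply]
    refine ⟨fun h k => ?_, fun h i => ?_⟩
    · by_cases hk : ∃ i, σ i = k
      · obtain ⟨i, rfl⟩ := hk
        rw [hσ.extend_apply]; exact h i
      · rw [Function.extend_apply' _ _ _ hk]; trivial
    · have := h (σ i)
      rwa [hσ.extend_apply] at this
  rw [Measure.map_apply hmeas (MeasurableSet.univ_pi hA), hpre, Measure.pi_pi]
  refine (Fintype.prod_of_injective σ hσ _ _ (fun k hk => ?_) fun i => ?_).symm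
  · rw [Function.extend_apply' _ _ _ (by simpa using hk), measure_univ]
  · rw [hσ.extend_apply]

end MeasureTheory

namespace MeasureTheory.Measure

/-- A nonempty subsingleton carries a single probability measure. -/
theorem eq_of_subsingleton {α : Type*} [MeasurableSpace α] [Subsingleton α] (μ ν : Measure α)
    [IsProbabilityMeasure μ] [IsProbabilityMeasure ν] : μ = ν := by
  ext s _
  rcases s.eq_empty_or_nonempty with rfl | h
  · simp
  · rw [Subsingleton.eq_univ_of_nonempty h, measure_univ, measure_univ]

end MeasureTheory.Measure

/-! ### From marginal systems to processes. -/

namespace MarginalSystem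

variable {T E : Type*} [MeasurableSpace E]

theorem measurable_comp {α β : Type*} (σ : α → β) : Measurable fun x : β → E => x ∘ σ :=
  measurable_pi_lambda _ fun _ => measurable_pi_apply _

variable {D : ∀ n : ℕ, Set (Fin n → T)} {P : MarginalSystem T E}

/-- Exchangeability and consistency combine to marginalisation along arbitrary injections. -/
theorem eq_map_comp_of_injective
    (hD : ∀ {m n : ℕ} {t : Fin n → T} {σ : Fin m → Fin n}, t ∈ D n → Function.Injective σ →
      t ∘ σ ∈ D m)
    (hprob : P.IsProbabilityOn D) (hexch : P.IsExchangeableOn D) (hcons : P.IsConsistentOn D)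
    {m n : ℕ} {t : Fin n → T} (ht : t ∈ D n) {σ : Fin m → Fin n} (hσ : Function.Injective σ) :
    P m (t ∘ σ) = (P n t).map fun x => x ∘ σ := by
  -- Consistency is assumed only for `1 ≤ m`; for `m = 0` both sides are probability measures on a
  -- point.
  rcases Nat.eq_zero_or_pos m with rfl | hm
  · have := hprob n t ht
    have := hprob 0 _ (hD ht hσ)
    have := Measure.isProbabilityMeasure_map (μ := P n t) (measurable_comp (E := E) σ).aemeasurable
    exact Measure.eq_of_subsingleton _ _
  · have hmn : m ≤ n := by simpa using Fintype.card_le_of_injective σ hσ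
    obtain ⟨π, hπ⟩ := Equiv.Perm.exists_extending_pair (Fin.castLE hmn) σ
      (Fin.castLE_injective hmn) hσ
    obtain rfl : σ = π ∘ Fin.castLE hmn := funext fun i => (hπ i).symm
    have h := hcons m n hm hmn (t ∘ π) (hD ht π.injective)
    rw [hexch n t ht π, Measure.map_map (measurable_comp _) (measurable_comp _)] at h
    exact h

/-- The process whose observation at `i` is taken at the index `ι i`. -/
theorem exists_process [StandardBorelSpace E]
    (hD : ∀ {m n : ℕ} {t : Fin n → T} {σ : Fin m → Fin n}, t ∈ D n → Function.Injective σ →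
      t ∘ σ ∈ D m)
    (hprob : P.IsProbabilityOn D) (hexch : P.IsExchangeableOn D) (hcons : P.IsConsistentOn D)
    {I : Type*} (ι : I → T)
    (hι : ∀ {n : ℕ} {s : Fin n → I}, Function.Injective s → ι ∘ s ∈ D n) :
    ∃ μ : Measure (I → E), IsProbabilityMeasure μ ∧
      ∀ (n : ℕ) (s : Fin n → I), Function.Injective s → μ.map (fun x => x ∘ s) = P n (ι ∘ s) := by
  let enum (J : Finset I) : Fin J.card → I := fun k => J.equivFin.symm k
  have enum_inj (J : Finset I) : Function.Injective (enum J) :=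
    Subtype.val_injective.comp J.equivFin.symm.injective
  let Q (J : Finset I) : Measure (J → E) :=
    (P J.card (ι ∘ enum J)).map fun x => x ∘ J.equivFin
  have hQprob (J : Finset I) : IsProbabilityMeasure (Q J) := by
    have := hprob _ _ (hι (enum_inj J))
    exact Measure.isProbabilityMeasure_map (measurable_comp _).aemeasurable
  have hQ : IsProjectiveMeasureFamily (α := fun _ => E) Q := by
    intro K J hJK
    let σ : Fin J.card → Fin K.card := fun k =>
      K.equivFin ⟨enum J k, hJK (J.equivFin.symm k).2⟩
    have henum : enum K ∘ σ = enum J := by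
      ext k
      simp [enum, σ]
    have hσ : Function.Injective σ := by
      refine Function.Injective.of_comp (f := enum K) ?_
      rw [henum]; exact enum_inj J
    have h := eq_map_comp_of_injective hD hprob hexch hcons (hι (enum_inj K)) hσ
    rw [Function.comp_assoc, henum] at h
    simp only [Q]
    rw [h, Measure.map_map (measurable_comp _) (measurable_comp _)]
    refine Eq.trans ?_ (Measure.map_map (g := Finset.restrict₂ (π := fun _ : I => E) hJK)
      (Finset.measurable_restrict₂ hJK) (measurable_comp _)).symm
    congr 1
    ext x j
    simp [σ, enum, Finset.restrict₂]
  obtain ⟨μ, hμ, hμQ⟩ := hQ.exists_isProjectiveLimit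
  refine ⟨μ, hμ, fun n s hs => ?_⟩
  classical
  let J : Finset I := Finset.univ.image s
  have hsJ (k : Fin n) : s k ∈ J := Finset.mem_image_of_mem _ (Finset.mem_univ k)
  let σ : Fin n → Fin J.card := fun k => J.equivFin ⟨s k, hsJ k⟩
  have henum : enum J ∘ σ = s := by
    ext k
    simp [enum, σ]
  have hσ : Function.Injective σ := by
    refine Function.Injective.of_comp (f := enum J) ?_
    rw [henum]; exact hs
  have h := eq_map_comp_of_injective hD hprob hexch hcons (hι (enum_inj J)) hσ
  rw [Function.comp_assoc, henum] at h
  have hsel := measurable_comp (E := E) fun k : Fin n => (⟨s k, hsJ k⟩ : J)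
  rw [h]
  refine (Measure.map_map hsel (Finset.measurable_restrict (X := fun _ => E) J)).symm.trans ?_
  rw [hμQ, Measure.map_map hsel (measurable_comp _)]
  rfl

/-- The law of a process is determined by its marginals at lists of distinct indices. -/
theorem measure_eq_of_map_comp_eq {I : Type*} {μ ν : Measure (I → E)} [IsFiniteMeasure μ]
    (h : ∀ (n : ℕ) (s : Fin n → I), Function.Injective s →
      μ.map (fun x => x ∘ s) = ν.map fun x => x ∘ s) : μ = ν := by
  refine IsProjectiveLimit.unique (α := fun _ => E)
    (P := fun J => μ.map (J.restrict (π := fun _ => E))) (fun J => rfl) fun J => ?_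
  have hfac : J.restrict (π := fun _ => E) = (fun x => x ∘ J.equivFin) ∘
      fun x : I → E => x ∘ fun k : Fin J.card => (J.equivFin.symm k : I) := by
    ext x j
    simp
  simp only [hfac]
  rw [← Measure.map_map (measurable_comp _) (measurable_comp _),
    ← Measure.map_map (μ := μ) (measurable_comp _) (measurable_comp _),
    h _ (fun k : Fin J.card => (J.equivFin.symm k : I))
      (Subtype.val_injective.comp J.equivFin.symm.injective)]

end MarginalSystem

/-! ### De Finetti's theorem by conditioning on the shift. -/

namespace ProbabilityTheory

section Spreadable

variable {Ω E : Type*} [MeasurableSpace Ω] [MeasurableSpace E] [StandardBorelSpace E] [Nonempty E]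
  {μ : Measure Ω} [IsProbabilityMeasure μ] {θ : Ω → Ω}

/-- Disintegration of the joint law of `(θ, Y)`. Only the target `E` must be standard Borel, so `θ`
may take values in arrays over an uncountable `T`. -/
theorem lintegral_mul_indicator_eq_condDistrib {Y : Ω → E} (hθ : Measurable θ) (hY : Measurable Y)
    {A : Set E} (hA : MeasurableSet A) {G : Ω → ENNReal} (hG : Measurable G) :
    ∫⁻ ω, G (θ ω) * A.indicator 1 (Y ω) ∂μ = ∫⁻ ω, G (θ ω) * condDistrib Y θ μ (θ ω) A ∂μ := by
  have hF : Measurable fun p : Ω × E => G p.1 * A.indicator 1 p.2 :=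
    (hG.comp measurable_fst).mul ((measurable_one.indicator hA).comp measurable_snd)
  calc ∫⁻ ω, G (θ ω) * A.indicator 1 (Y ω) ∂μ
      = ∫⁻ p, G p.1 * A.indicator 1 p.2 ∂(μ.map fun ω => (θ ω, Y ω)) :=
        (lintegral_map hF (hθ.prodMk hY)).symm
    _ = ∫⁻ ω, ∫⁻ y, G (θ ω) * A.indicator 1 y ∂(condDistrib Y θ μ (θ ω)) ∂μ := by
        rw [← compProd_map_condDistrib hY.aemeasurable, Measure.lintegral_compProd hF,
          lintegral_map (hF.lintegral_kernel_prod_right' (κ := condDistrib Y θ μ)) hθ]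
    _ = ∫⁻ ω, G (θ ω) * condDistrib Y θ μ (θ ω) A ∂μ := by
        refine lintegral_congr fun ω => ?_
        rw [lintegral_const_mul _ (measurable_one.indicator hA), lintegral_indicator_one hA]

/-- If `(θ, Y)` and `(θ ∘ θ, Y)` have the same law, then conditioning `Y` on `θ` gives the same as
conditioning on the coarser `θ ∘ θ`. -/
theorem condDistrib_comp_ae_eq {Y : Ω → E} (hθ : MeasurePreserving θ μ μ) (hY : Measurable Y)
    (hθY : μ.map (fun ω => (θ (θ ω), Y ω)) = μ.map fun ω => (θ ω, Y ω))
    {A : Set E} (hA : MeasurableSet A) :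
    (fun ω => condDistrib Y θ μ (θ (θ ω)) A) =ᵐ[μ] fun ω => condDistrib Y θ μ (θ ω) A := by
  set κ := condDistrib Y θ μ
  have hκ : Measurable fun ω => κ ω A := Kernel.measurable_coe κ hA
  have hu : Measurable fun ω => κ (θ ω) A := hκ.comp hθ.measurable
  have hv : Measurable fun ω => κ (θ (θ ω)) A := hu.comp hθ.measurable
  have hle (ω : Ω) : κ ω A ≤ 1 := prob_le_one
  have hF : Measurable fun p : Ω × E => κ p.1 A * A.indicator 1 p.2 :=
    (hκ.comp measurable_fst).mul ((measurable_one.indicator hA).comp measurable_snd)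
  have hvv : ∫⁻ ω, κ (θ (θ ω)) A * κ (θ (θ ω)) A ∂μ = ∫⁻ ω, κ (θ ω) A * κ (θ ω) A ∂μ :=
    hθ.lintegral_comp (hu.mul hu)
  -- Each side is first rewritten as an integral against the indicator of `Y ∈ A`; `hθY` then
  -- identifies the two.
  have huv : ∫⁻ ω, κ (θ (θ ω)) A * κ (θ ω) A ∂μ = ∫⁻ ω, κ (θ ω) A * κ (θ ω) A ∂μ := by
    rw [← lintegral_mul_indicator_eq_condDistrib hθ.measurable hY hA hu,
      ← lintegral_mul_indicator_eq_condDistrib hθ.measurable hY hA hκ,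
      ← lintegral_map hF (hθ.measurable.prodMk hY), ← hθY]
    exact (lintegral_map hF ((hθ.measurable.comp hθ.measurable).prodMk hY)).symm
  -- The square of the difference is expanded in `ℝ`, since subtraction in `ENNReal` is truncated.
  have toReal_int {a b : Ω → ENNReal} (ha : Measurable a) (hb : Measurable b)
      (ha1 : ∀ ω, a ω ≤ 1) (hb1 : ∀ ω, b ω ≤ 1) :
      Integrable (fun ω => (a ω).toReal * (b ω).toReal) μ ∧
        ∫ ω, (a ω).toReal * (b ω).toReal ∂μ = (∫⁻ ω, a ω * b ω ∂μ).toReal := by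
    have hab1 (ω : Ω) : a ω * b ω ≤ 1 := mul_le_one' (ha1 ω) (hb1 ω)
    simp_rw [← ENNReal.toReal_mul]
    refine ⟨integrable_toReal_of_lintegral_ne_top (ha.mul hb).aemeasurable ?_,
      integral_toReal (ha.mul hb).aemeasurable
        (Filter.Eventually.of_forall fun ω => (hab1 ω).trans_lt ENNReal.one_lt_top)⟩
    refine ((lintegral_mono hab1).trans_lt ?_).ne
    simp
  obtain ⟨iuu, euu⟩ := toReal_int hu hu (fun _ => hle _) fun _ => hle _
  obtain ⟨ivv, evv⟩ := toReal_int hv hv (fun _ => hle _) fun _ => hle _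
  obtain ⟨ivu, evu⟩ := toReal_int hv hu (fun _ => hle _) fun _ => hle _
  have hsq : ∫ ω, ((κ (θ (θ ω)) A).toReal - (κ (θ ω) A).toReal) ^ 2 ∂μ = 0 := by
    have hexp (ω : Ω) : ((κ (θ (θ ω)) A).toReal - (κ (θ ω) A).toReal) ^ 2 =
        (κ (θ (θ ω)) A).toReal * (κ (θ (θ ω)) A).toReal
          - 2 * ((κ (θ (θ ω)) A).toReal * (κ (θ ω) A).toReal)
          + (κ (θ ω) A).toReal * (κ (θ ω) A).toReal := by ring
    simp_rw [hexp]
    refine (integral_add (ivv.sub (ivu.const_mul 2)) iuu).trans ?_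
    rw [integral_sub' ivv (ivu.const_mul 2),
      integral_const_mul, euu, evv, evu, hvv, huv]
    ring
  have hint : Integrable (fun ω => ((κ (θ (θ ω)) A).toReal - (κ (θ ω) A).toReal) ^ 2) μ := by
    refine ((ivv.sub (ivu.const_mul 2)).add iuu).congr (Filter.Eventually.of_forall fun ω => ?_)
    simp only [Pi.add_apply, Pi.sub_apply]
    ring
  rw [integral_eq_zero_iff_of_nonneg (fun ω => sq_nonneg _) hint] at hsq
  filter_upwards [hsq] with ω hω
  have := sub_eq_zero.1 (pow_eq_zero_iff two_ne_zero |>.1 hω)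
  exact (ENNReal.toReal_eq_toReal_iff' (measure_ne_top _ _) (measure_ne_top _ _)).1 this

variable {T : Type*} {X : T → Ω → E}

/-- The invariant weight `H` collects the factors already treated. All factors but the first are
functions of `θ ω`, so the first indicator becomes a conditional probability. By its invariance that
too is a function of `θ (θ ω)`, so stationarity removes one shift, and it is absorbed into `H`. -/
theorem lintegral_mul_prod_indicator_iterate (hθ : MeasurePreserving θ μ μ)
    (hX : ∀ t, Measurable (X t))
    (hθX : ∀ t, μ.map (fun ω => (θ (θ ω), X t ω)) = μ.map fun ω => (θ ω, X t ω))
    {n : ℕ} (t : Fin n → T) {A : Fin n → Set E} (hA : ∀ j, MeasurableSet (A j))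
    {H : Ω → ENNReal} (hH : Measurable H) (hHθ : (fun ω => H (θ ω)) =ᵐ[μ] H) :
    ∫⁻ ω, H ω * ∏ j, (A j).indicator 1 (X (t j) (θ^[j] ω)) ∂μ =
      ∫⁻ ω, H ω * ∏ j, condDistrib (X (t j)) θ μ (θ ω) (A j) ∂μ := by
  induction n generalizing H with
  | zero => simp
  | succ n ih =>
    have hθm := hθ.measurable
    have hg : Measurable fun ω => condDistrib (X (t 0)) θ μ (θ ω) (A 0) :=
      (Kernel.measurable_coe _ (hA 0)).comp hθm
    have hprod : Measurable fun ω =>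
        ∏ j : Fin n, (A j.succ).indicator (1 : E → ENNReal) (X (t j.succ) (θ^[j] ω)) :=
      Finset.measurable_prod _ fun j _ =>
        (measurable_one.indicator (hA j.succ)).comp ((hX _).comp (hθm.iterate _))
    have hinv := condDistrib_comp_ae_eq hθ (hX (t 0)) (hθX (t 0)) (hA 0)
    calc ∫⁻ ω, H ω * ∏ j, (A j).indicator 1 (X (t j) (θ^[j] ω)) ∂μ
        = ∫⁻ ω, H (θ ω) * (∏ j : Fin n, (A j.succ).indicator 1 (X (t j.succ) (θ^[j] (θ ω))))
            * (A 0).indicator 1 (X (t 0) ω) ∂μ := by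
          refine lintegral_congr_ae ?_
          filter_upwards [hHθ] with ω hω
          rw [Fin.prod_univ_succ, hω]
          simp only [Fin.val_zero, Fin.val_succ, Function.iterate_zero, id, Function.iterate_succ,
            Function.comp_apply]
          ring
      _ = ∫⁻ ω, H (θ ω) * (∏ j : Fin n, (A j.succ).indicator 1 (X (t j.succ) (θ^[j] (θ ω))))
            * condDistrib (X (t 0)) θ μ (θ ω) (A 0) ∂μ :=
          lintegral_mul_indicator_eq_condDistrib hθm (hX _) (hA 0) (hH.mul hprod)
      _ = ∫⁻ ω, H (θ ω) * (∏ j : Fin n, (A j.succ).indicator 1 (X (t j.succ) (θ^[j] (θ ω))))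
            * condDistrib (X (t 0)) θ μ (θ (θ ω)) (A 0) ∂μ := by
          refine lintegral_congr_ae ?_
          filter_upwards [hinv] with ω hω
          rw [hω]
      _ = ∫⁻ ω, H ω * (∏ j : Fin n, (A j.succ).indicator 1 (X (t j.succ) (θ^[j] ω)))
            * condDistrib (X (t 0)) θ μ (θ ω) (A 0) ∂μ :=
          hθ.lintegral_comp ((hH.mul hprod).mul hg)
      _ = ∫⁻ ω, (H ω * condDistrib (X (t 0)) θ μ (θ ω) (A 0)) *
            ∏ j : Fin n, (A j.succ).indicator 1 (X (t j.succ) (θ^[j] ω)) ∂μ :=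
          lintegral_congr fun ω => mul_right_comm _ _ _
      _ = ∫⁻ ω, (H ω * condDistrib (X (t 0)) θ μ (θ ω) (A 0)) *
            ∏ j : Fin n, condDistrib (X (t j.succ)) θ μ (θ ω) (A j.succ) ∂μ := by
          refine ih (fun j => t j.succ) (fun j => hA j.succ) (hH.mul hg) ?_
          filter_upwards [hHθ, hinv] with ω h1 h2
          simp only [h1, h2]
      _ = ∫⁻ ω, H ω * ∏ j, condDistrib (X (t j)) θ μ (θ ω) (A j) ∂μ := by
          refine lintegral_congr fun ω => ?_
          rw [Fin.prod_univ_succ, mul_assoc]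

/-- **De Finetti's theorem** for a stationary family of sequences `j ↦ X t ∘ θ^[j]`: along any list
of indices, the observations `X (t j) ∘ θ^[j]` are conditionally independent with laws given by
the conditional distributions of the `X t` given the shift `θ`. -/
theorem measure_iterate_mem_eq_lintegral_prod_condDistrib (hθ : MeasurePreserving θ μ μ)
    (hX : ∀ t, Measurable (X t))
    (hθX : ∀ t, μ.map (fun ω => (θ (θ ω), X t ω)) = μ.map fun ω => (θ ω, X t ω))
    {n : ℕ} (t : Fin n → T) {A : Fin n → Set E} (hA : ∀ j, MeasurableSet (A j)) :
    μ {ω | ∀ j, X (t j) (θ^[j] ω) ∈ A j} =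
      ∫⁻ ω, ∏ j, condDistrib (X (t j)) θ μ ω (A j) ∂μ := by
  have h := lintegral_mul_prod_indicator_iterate hθ hX hθX t hA measurable_one
    (Filter.EventuallyEq.rfl)
  simp only [Pi.one_apply, one_mul] at h
  have hmeas : MeasurableSet {ω | ∀ j, X (t j) (θ^[j] ω) ∈ A j} := by
    rw [Set.ofPred_forall]
    exact MeasurableSet.iInter fun j => ((hX (t j)).comp (hθ.measurable.iterate _)) (hA j)
  -- Stationarity lets the kernels be evaluated at `ω` instead of `θ ω`, so `μ` itself can be the
  -- prior.
  rw [← hθ.lintegral_comp (f := fun ω => ∏ j, condDistrib (X (t j)) θ μ ω (A j))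
    (Finset.measurable_prod _ fun j _ => Kernel.measurable_coe _ (hA j)), ← h,
    ← lintegral_indicator_one hmeas]
  refine lintegral_congr fun ω => ?_
  classical
  simp only [Set.indicator_apply, Set.mem_ofPred_eq, Pi.one_apply, Finset.prod_ite_zero,
    Finset.mem_univ, forall_true_left, Finset.prod_const_one]

end Spreadable

end ProbabilityTheory

/-! ### Marginals of a model and change of latent space. -/

namespace LatentVariableModel

variable {Θ T E : Type*} [MeasurableSpace Θ] [MeasurableSpace E]

theorem observations_apply (M : LatentVariableModel Θ T E) {n : ℕ} (t : Fin n → T) (θ : Θ) :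
    M.observations t θ = Measure.pi fun i => M.likelihood (t i) θ := rfl

theorem isProbabilityMeasure_marginals (M : LatentVariableModel Θ T E) {n : ℕ} (t : Fin n → T) :
    IsProbabilityMeasure (M.marginals n t) := by
  have := M.isProbabilityMeasure_prior
  have := M.isMarkovKernel_likelihood
  have : IsMarkovKernel (M.observations t) :=
    ⟨fun θ => by rw [observations_apply]; infer_instance⟩
  unfold marginals
  infer_instance

theorem marginals_apply (M : LatentVariableModel Θ T E) {n : ℕ} (t : Fin n → T)
    {s : Set (Fin n → E)} (hs : MeasurableSet s) :
    M.marginals n t s = ∫⁻ θ, Measure.pi (fun i => M.likelihood (t i) θ) s ∂M.prior :=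
  Measure.bind_apply hs (M.observations t).aemeasurable

/-- To identify the marginals of a model it suffices to compute them on boxes. -/
theorem eq_marginals (M : LatentVariableModel Θ T E) {n : ℕ} (t : Fin n → T)
    {ν : Measure (Fin n → E)} [IsFiniteMeasure ν]
    (h : ∀ A : Fin n → Set E, (∀ i, MeasurableSet (A i)) →
      ν (Set.univ.pi A) = ∫⁻ θ, ∏ i, M.likelihood (t i) θ (A i) ∂M.prior) :
    ν = M.marginals n t := by
  have := M.isMarkovKernel_likelihood
  have hbox (A : Fin n → Set E) (hA : ∀ i, MeasurableSet (A i)) :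
      ν (Set.univ.pi A) = M.marginals n t (Set.univ.pi A) := by
    rw [h A hA, marginals_apply M t (MeasurableSet.univ_pi hA)]
    simp_rw [Measure.pi_pi]
  refine ext_of_generate_finite _ generateFrom_pi.symm isPiSystem_pi ?_ ?_
  · rintro _ ⟨A, hA, rfl⟩
    exact hbox A fun i => hA i (Set.mem_univ i)
  · simpa using hbox (fun _ => Set.univ) fun _ => MeasurableSet.univ

/-- True under the integral for each fixed latent value. Permutations give exchangeability, initial
segments give consistency. -/
theorem marginals_comp_injective (M : LatentVariableModel Θ T E) {m n : ℕ} (t : Fin n → T)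
    {σ : Fin m → Fin n} (hσ : Function.Injective σ) :
    M.marginals m (t ∘ σ) = (M.marginals n t).map fun x => x ∘ σ := by
  have := M.isMarkovKernel_likelihood
  have hcomp := MarginalSystem.measurable_comp (E := E) σ
  ext s hs
  rw [Measure.map_apply hcomp hs, marginals_apply M _ hs, marginals_apply M _ (hcomp hs)]
  refine lintegral_congr fun θ => ?_
  rw [← Measure.map_apply hcomp hs, Measure.pi_map_comp_injective _ hσ]
  rfl

/-- Moving the latent variable along an injection with a measurable left inverse. -/
noncomputable def transport (M : LatentVariableModel Θ T E) {Θ' : Type*} [MeasurableSpace Θ']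
    {e : Θ → Θ'} (he : Measurable e) {d : Θ' → Θ} (hd : Measurable d) :
    LatentVariableModel Θ' T E where
  prior := M.prior.map e
  likelihood t := (M.likelihood t).comap d hd
  isProbabilityMeasure_prior :=
    have := M.isProbabilityMeasure_prior
    Measure.isProbabilityMeasure_map he.aemeasurable
  isMarkovKernel_likelihood t :=
    have := M.isMarkovKernel_likelihood t
    inferInstance

theorem marginals_transport (M : LatentVariableModel Θ T E) {Θ' : Type*} [MeasurableSpace Θ']
    {e : Θ → Θ'} (he : Measurable e) {d : Θ' → Θ} (hd : Measurable d) (hde : ∀ θ, d (e θ) = θ)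
    {n : ℕ} (t : Fin n → T) : (M.transport he hd).marginals n t = M.marginals n t := by
  ext s hs
  rw [marginals_apply _ t hs, marginals_apply _ t hs]
  have hmeas : Measurable fun θ' =>
      Measure.pi (fun i => (M.transport he hd).likelihood (t i) θ') s :=
    ((M.transport he hd).observations t).measurable_coe hs
  rw [show (M.transport he hd).prior = M.prior.map e from rfl, lintegral_map hmeas he]
  refine lintegral_congr fun θ => ?_
  simp only [transport, Kernel.comap_apply, hde]

/-- A model whose latent variable is a family of points of a standard Borel space can be
re-encoded with a family of real numbers as its latent variable. -/
theorem exists_represents_real {S : Type*} [StandardBorelSpace E] [Nonempty E]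
    (M : LatentVariableModel (S → E) T E) {D : ∀ n : ℕ, Set (Fin n → T)} {P : MarginalSystem T E}
    (h : M.Represents D P) : ∃ M' : LatentVariableModel (S → ℝ) T E, M'.Represents D P := by
  -- A measurable left inverse of the embedding; applied coordinatewise, it needs no countability of
  -- `S`.
  obtain ⟨d, hd, hde⟩ := (measurableEmbedding_embeddingReal E).exists_measurable_extend
    measurable_id fun _ => inferInstance
  have he' : Measurable fun (x : S → E) s => embeddingReal E (x s) :=
    measurable_pi_lambda _ fun s =>
      (measurableEmbedding_embeddingReal E).measurable.comp (measurable_pi_apply s)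
  have hd' : Measurable fun (y : S → ℝ) s => d (y s) :=
    measurable_pi_lambda _ fun s => hd.comp (measurable_pi_apply s)
  refine ⟨M.transport he' hd', fun n t ht => ?_⟩
  rw [h n t ht, marginals_transport M he' hd' fun x => funext fun s => congrFun hde (x s)]

/-- The marginals of a latent-variable model are exchangeable and consistent. -/
theorem Represents.exchangeable_consistent {M : LatentVariableModel Θ T E}
    {D : ∀ n : ℕ, Set (Fin n → T)} {P : MarginalSystem T E}
    (hD : ∀ {m n : ℕ} {t : Fin n → T} {σ : Fin m → Fin n}, t ∈ D n → Function.Injective σ →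
      t ∘ σ ∈ D m)
    (h : M.Represents D P) : P.IsProbabilityOn D ∧ P.IsExchangeableOn D ∧ P.IsConsistentOn D := by
  refine ⟨fun n t ht => ?_, fun n t ht π => ?_, fun m n _ hmn t ht => ?_⟩
  · rw [h n t ht]
    exact M.isProbabilityMeasure_marginals t
  · rw [h n t ht, h n _ (hD ht π.injective), M.marginals_comp_injective t π.injective]
  · have hinj := Fin.castLE_injective hmn
    rw [h n t ht, h m _ (hD ht hinj), M.marginals_comp_injective t hinj]

end LatentVariableModel

/-! ### Construction of the representing models. -/

namespace MarginalSystem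

variable {T E : Type*} [MeasurableSpace E] {P : MarginalSystem T E}

/-- Only the empty list exists, and its observation space is a point. The case stands apart because
`E` may be empty. -/
theorem exists_represents_of_isEmpty [IsEmpty T] {D : ∀ n : ℕ, Set (Fin n → T)}
    (hprob : P.IsProbabilityOn D) :
    ∃ M : LatentVariableModel (T → ℝ) T E, M.Represents D P := by
  refine ⟨⟨Measure.dirac 0, isEmptyElim, inferInstance, isEmptyElim⟩, fun n t ht => ?_⟩
  have hn : IsEmpty (Fin n) := Function.isEmpty t
  have := hprob n t ht
  have := LatentVariableModel.isProbabilityMeasure_marginals (E := E)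
    ⟨Measure.dirac (0 : T → ℝ), isEmptyElim, inferInstance, isEmptyElim⟩ t
  exact Measure.eq_of_subsingleton _ _

/-- With pairwise distinct indices, the path of the process itself serves as latent variable. -/
theorem exists_represents_distinctIndices [StandardBorelSpace E]
    (hprob : P.IsProbabilityOn (distinctIndices T)) (hexch : P.IsExchangeableOn (distinctIndices T))
    (hcons : P.IsConsistentOn (distinctIndices T)) :
    ∃ M : LatentVariableModel (T → E) T E, M.Represents (distinctIndices T) P := by
  obtain ⟨μ, hμ, hμP⟩ := exists_process (D := distinctIndices T)
    (fun ht hσ => Function.Injective.comp ht hσ) hprob hexch hcons (id : T → T) fun hs => hs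
  refine ⟨⟨μ, fun t => Kernel.deterministic (fun x => x t) (measurable_pi_apply t), hμ,
    fun t => inferInstance⟩, fun n t ht => ?_⟩
  have := hprob n t ht
  refine LatentVariableModel.eq_marginals _ t fun A hA => ?_
  have hcomp := measurable_comp (E := E) t
  have hbox := MeasurableSet.univ_pi hA
  rw [← Function.id_comp t, ← hμP n t ht, Measure.map_apply hcomp hbox,
    ← lintegral_indicator_one (hcomp hbox)]
  refine lintegral_congr fun x => ?_
  classical
  simp only [Kernel.deterministic_apply, Measure.dirac_apply' _ (hA _), Set.indicator_apply,
    Set.mem_preimage, Set.mem_univ_pi, Function.comp_apply, id, Pi.one_apply,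
    Finset.prod_ite_zero, Finset.mem_univ, forall_true_left, Finset.prod_const_one]

/-- With repetitions allowed, an array of infinitely many observations at each index serves as
latent variable. -/
theorem exists_represents_allIndices [StandardBorelSpace E] [Nonempty E]
    (hprob : P.IsProbabilityOn (allIndices T)) (hexch : P.IsExchangeableOn (allIndices T))
    (hcons : P.IsConsistentOn (allIndices T)) :
    ∃ M : LatentVariableModel (T × ℕ → E) T E, M.Represents (allIndices T) P := by
  obtain ⟨μ, hμ, hμP⟩ := exists_process (D := allIndices T) (fun _ _ => trivial) hprob hexch hcons
    (Prod.fst : T × ℕ → T) fun _ => trivial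
  have hinv (σ : T × ℕ → T × ℕ) (hσ : Function.Injective σ) (hfst : Prod.fst ∘ σ = Prod.fst) :
      μ.map (fun x => x ∘ σ) = μ := by
    have := Measure.isProbabilityMeasure_map (μ := μ) (measurable_comp (E := E) σ).aemeasurable
    refine measure_eq_of_map_comp_eq fun n s hs => ?_
    rw [Measure.map_map (measurable_comp _) (measurable_comp _)]
    change μ.map (fun x => x ∘ (σ ∘ s)) = _
    rw [hμP n _ (hσ.comp hs), hμP n s hs, ← Function.comp_assoc, hfst]
  let succ : T × ℕ → T × ℕ := fun p => (p.1, p.2 + 1)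
  have succ_inj : Function.Injective succ := fun p q h => by
    simp only [succ, Prod.mk.injEq, Nat.add_right_cancel_iff] at h
    exact Prod.ext h.1 h.2
  let θ : (T × ℕ → E) → (T × ℕ → E) := fun x => x ∘ succ
  let X (t : T) : (T × ℕ → E) → E := fun x => x (t, 0)
  have hθ : MeasurePreserving θ μ μ := ⟨measurable_comp _, hinv succ succ_inj rfl⟩
  have hX (t : T) : Measurable (X t) := measurable_pi_apply _
  have hθX (t : T) : μ.map (fun x => (θ (θ x), X t x)) = μ.map fun x => (θ x, X t x) := by
    -- `skip` fixes column 0 and moves the others one step right, so it keeps `X t` and turns `θ`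
    -- into `θ ∘ θ`.
    let skip : T × ℕ → T × ℕ := fun p => (p.1, if p.2 = 0 then 0 else p.2 + 1)
    have skip_inj : Function.Injective skip := fun p q h => by
      simp only [skip, Prod.mk.injEq] at h
      refine Prod.ext h.1 ?_
      have := h.2
      split_ifs at this <;> omega
    conv_rhs => rw [← hinv skip skip_inj rfl]
    rw [Measure.map_map (hθ.measurable.prodMk (hX t)) (measurable_comp _)]
    rfl
  have hiter (j : ℕ) (x : T × ℕ → E) (t : T) : X t (θ^[j] x) = x (t, j) := by
    have (k : ℕ) : θ^[j] x (t, k) = x (t, k + j) := by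
      induction j generalizing x with
      | zero => rfl
      | succ j ih =>
        rw [Function.iterate_succ_apply, ih]
        simp only [θ, succ, Function.comp_apply, add_assoc]
    simpa using this 0
  refine ⟨⟨μ, fun t => condDistrib (X t) θ μ, hμ, fun t => inferInstance⟩, fun n t ht => ?_⟩
  have := hprob n t ht
  refine LatentVariableModel.eq_marginals _ t fun A hA => ?_
  -- The `j`-th observation is read in column `j`, so the cells are distinct even when indices
  -- repeat.
  let s : Fin n → T × ℕ := fun j => (t j, j)
  have hs : Function.Injective s := fun i j h => Fin.ext (Prod.ext_iff.1 h).2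
  rw [← measure_iterate_mem_eq_lintegral_prod_condDistrib hθ hX hθX t hA,
    show t = Prod.fst ∘ s from rfl, ← hμP n s hs,
    Measure.map_apply (measurable_comp _) (MeasurableSet.univ_pi hA)]
  congr 1
  ext x
  simp only [Set.mem_preimage, Set.mem_univ_pi, Set.mem_ofPred_eq, hiter]
  rfl

end MarginalSystem

theorem theorem1 {T : Type u} {E : Type v} [MeasurableSpace E] [StandardBorelSpace E]
    (D : ∀ n : ℕ, Set (Fin n → T)) (hD : D = distinctIndices T ∨ D = allIndices T)
    (P : MarginalSystem T E) :
    (P.IsProbabilityOn D → P.IsExchangeableOn D → P.IsConsistentOn D →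
      ∃ (S : Type u) (M : LatentVariableModel (S → ℝ) T E), M.Represents D P) ∧
    (∀ (Θ : Type w) [MeasurableSpace Θ] (M : LatentVariableModel Θ T E), M.Represents D P →
      P.IsProbabilityOn D ∧ P.IsExchangeableOn D ∧ P.IsConsistentOn D) := by
  refine ⟨fun hprob hexch hcons => ?_, fun Θ _ M hM =>
    LatentVariableModel.Represents.exchangeable_consistent (fun ht hσ => ?_) hM⟩
  · rcases isEmpty_or_nonempty T with hT | ⟨⟨t₀⟩⟩
    · exact ⟨T, MarginalSystem.exists_represents_of_isEmpty hprob⟩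
    -- Lists of length one are admissible in both settings, and a probability measure lives on a
    -- nonempty space.
    have hE : Nonempty E := by
      have hmem : (fun _ : Fin 1 => t₀) ∈ D 1 := by
        rcases hD with rfl | rfl
        · exact Function.injective_of_subsingleton _
        · trivial
      have := hprob 1 _ hmem
      obtain ⟨x⟩ := nonempty_of_isProbabilityMeasure (P 1 fun _ => t₀)
      exact ⟨x 0⟩
    rcases hD with rfl | rfl
    · obtain ⟨M, hM⟩ := MarginalSystem.exists_represents_distinctIndices hprob hexch hcons
      exact ⟨T, M.exists_represents_real hM⟩
    · obtain ⟨M, hM⟩ := MarginalSystem.exists_represents_allIndices hprob hexch hcons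
      exact ⟨T × ℕ, M.exists_represents_real hM⟩
  · rcases hD with rfl | rfl
    · exact Function.Injective.comp ht hσ
    · trivial
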